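/- Let $\alpha\in\mathbb R\setminus\mathbb Q$, let $d\ge 0$, and let $\varphi_0,\dots,\varphi_d$ be germs at $0\in\mathbb C$ of holomorphic functions of one complex variable with $\varphi_i(z)=O(z^2)$. For $t\in\mathbb C$ consider the germ $$f_t(z)=e^{2\pi i\alpha}z+\sum_{i=0}^{d}t^i\varphi_i(z).$$ For a germ $f$ of holomorphic diffeomorphism of $(\mathbb C,0)$, let $\mathrm{Cent}(f)$ be the group of all germs $g$ of holomorphic diffeomorphisms of $(\mathbb C,0)$ (so $g(0)=0$, $g'(0)\neq 0$) with $g\circ f=f\circ g$, and let $G(f)\subset\mathbb T=\mathbb R/\mathbb Z$ be the set of all $\beta\in\mathbb T$ such that $g'(0)=e^{2\pi i\beta}$ for some $g\in\mathrm{Cent}(f)$. A set $E\subset\mathbb C$ is called polar if $\iint\log|z-w|\,d\mu(z)\,d\mu(w)=-\infty$ for every nonzero finite Borel measure $\mu$ supported on a compact subset of $E$. Then for every $\beta\in\mathbb T$ exactly one of the following two alternatives holds: 1) $\beta\in G(f_t)$ for all $t\in\mathbb C$; 2) there is a Borel polar set $E\subset\mathbb C$ such that $\beta\notin G(f_t)$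 for all $t\in\mathbb C\setminus E$. -/

import Mathlib

open Filter Topology MeasureTheory

namespace SmallDivisors

/-- `f` represents an element of the group `Diff (ℂ, 0)` of germs of holomorphic diffeomorphisms
of `(ℂ, 0)`. Germs are represented by functions, and equality of germs is equality near `0`. -/
def IsDiffGerm (f : ℂ → ℂ) : Prop :=
  AnalyticAt ℂ f 0 ∧ f 0 = 0 ∧ deriv f 0 ≠ 0

/-- The (representatives of) elements of the centralizer of the germ of `f` in `Diff (ℂ, 0)`:
`g ∘ f = f ∘ g` as germs at `0`. -/
def centralizer (f : ℂ → ℂ) : Set (ℂ → ℂ) :=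
  {g | IsDiffGerm g ∧ g ∘ f =ᶠ[𝓝 0] f ∘ g}

/-- The rotation-number image `G(f) ⊆ 𝕋 = ℝ / ℤ` of the centralizer of `f`: the classes `β` for
which some `g` in the centralizer has multiplier `g'(0) = exp (2 π i β)`. -/
def rotationSet (f : ℂ → ℂ) : Set UnitAddCircle :=
  {β | ∃ g ∈ centralizer f, deriv g 0 = (AddCircle.toCircle β : ℂ)}

/-- The polynomial family `f_t(z) = exp (2 π i α) z + ∑_{i = 0}^{d} t ^ i φ_i(z)`. -/
noncomputable def family (α : ℝ) (d : ℕ) (φ : Fin (d + 1) → ℂ → ℂ) (t : ℂ) : ℂ → ℂ :=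
  fun z ↦ Complex.exp (2 * Real.pi * Complex.I * α) * z + ∑ i : Fin (d + 1), t ^ (i : ℕ) * φ i z

/-- The positive part of the logarithmic kernel `log (1 / |z - w|)`, equal to `+∞` on the
diagonal. -/
noncomputable def logKernel (z w : ℂ) : ENNReal :=
  if z = w then ⊤ else ENNReal.ofReal (-Real.log ‖z - w‖)

/-- `E ⊆ ℂ` is polar: every nonzero finite Borel measure supported on a compact subset of `E` has
logarithmic energy `∬ log |z - w| dμ(z) dμ(w) = -∞`. Since `log |z - w|` is bounded above on
`K × K` for `K` compact, this says that the integral of its negative part is infinite. -/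
def IsPolar (E : Set ℂ) : Prop :=
  ∀ K ⊆ E, IsCompact K → ∀ μ : Measure ℂ, IsFiniteMeasure μ → μ ≠ 0 → μ Kᶜ = 0 →
    ∫⁻ z, ∫⁻ w, logKernel z w ∂μ ∂μ = ⊤

end SmallDivisors

/-!
# Rotation numbers of centralizers in polynomial families

Since `α` is irrational, the multiplier `l = exp (2 π i α)` satisfies `l ^ n ≠ l` for `n ≥ 2`, so
there is exactly one formal power series `G` with multiplier `exp (2 π i β)` commuting with the
Taylor series of `f_t`. Hence `β` lies in the rotation set of `f_t` exactly when `G` converges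
(`exists_mem_centralizer_iff`). Solving the commutation relation degree by degree over the ring
`ℂ[t]` shows that the coefficient of degree `n` of `G` is a polynomial in `t` of degree at most
`d * (n - 1)` (`hasWeight_commSeries`).

So the parameters `t` in question form the convergence set of a sequence of polynomials `b n` with
`deg (b n) ≤ d * n`, the countable union over `M` of the closed sets where
`‖b n (t)‖ ≤ M ^ (n + 1)` for all `n`. If it is not polar, one of these closed sets carries a
probability measure with bounded logarithmic potential (`exists_bounded_potential`). The
Bernstein–Walsh inequality (`exists_norm_eval_le_mul_pow`), obtained by factoring the polynomials
and averaging over that measure, then gives geometric bounds at every `t`, so the convergence set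
is the whole plane. The two alternatives exclude each other because the plane is not polar
(`not_isPolar_univ`).
-/

namespace SmallDivisors

/-! ### Logarithmic potentials -/

lemma measurable_logKernel : Measurable (Function.uncurry logKernel) :=
  Measurable.ite (measurableSet_eq_fun measurable_fst measurable_snd) measurable_const
    (by fun_prop)

lemma measurable_logKernel_right (r : ℂ) : Measurable (logKernel r) :=
  measurable_logKernel.comp measurable_prodMk_left

lemma logKernel_le_add_log_two {z z' w : ℂ} (h : ‖z' - w‖ ≤ 2 * ‖z - w‖) :
    logKernel z w ≤ logKernel z' w + ENNReal.ofReal (Real.log 2) := by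
  unfold logKernel
  by_cases hz' : z' = w
  · simp [hz']
  have h1 : 0 < ‖z' - w‖ := norm_pos_iff.2 (sub_ne_zero.2 hz')
  have h2 : 0 < ‖z - w‖ := by linarith
  have hz : z ≠ w := by
    rintro rfl
    simp at h2
  rw [if_neg hz, if_neg hz']
  refine le_trans (ENNReal.ofReal_le_ofReal ?_) ENNReal.ofReal_add_le
  have := Real.log_le_log h1 h
  rw [Real.log_mul two_ne_zero h2.ne'] at this
  linarith

/-- If a measure of finite energy charges `S`, then some compact subset of `S` carries a
probability measure whose potential is bounded on the whole plane. The potential is first bounded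
on the support by restriction; an arbitrary point `r` is then compared with a nearest point `r'` of
the support, for which `‖r' - w‖ ≤ 2 * ‖r - w‖`. -/
lemma exists_bounded_potential {μ : Measure ℂ} [IsFiniteMeasure μ] {S : Set ℂ}
    (hS : MeasurableSet S) (hμS : μ S ≠ 0)
    (hE : ∫⁻ z, ∫⁻ w, logKernel z w ∂μ ∂μ ≠ ⊤) :
    ∃ F ⊆ S, IsCompact F ∧ ∃ ν : Measure ℂ, IsProbabilityMeasure ν ∧ ν Fᶜ = 0 ∧
      ∃ C : NNReal, ∀ r, ∫⁻ w, logKernel r w ∂ν ≤ C := by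
  set p : ℂ → ENNReal := fun z ↦ ∫⁻ w, logKernel z w ∂μ with hp
  have hpm : Measurable p := measurable_logKernel.lintegral_prod_right'
  have hfin : ∀ᵐ z ∂μ, p z < ⊤ := ae_lt_top hpm hE
  obtain ⟨L, hL⟩ : ∃ L : ℕ, μ (S ∩ {z | p z ≤ L}) ≠ 0 := by
    by_contra! h
    have h1 : μ (⋃ L : ℕ, S ∩ {z | p z ≤ L}) = 0 := measure_iUnion_null h
    refine hμS (measure_mono_null_ae ?_ h1)
    filter_upwards [hfin] with z hz hzS
    obtain ⟨n, hn⟩ := ENNReal.exists_nat_gt hz.ne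
    exact Set.mem_iUnion.2 ⟨n, hzS, hn.le⟩
  obtain ⟨F, hFS, hF, hF0⟩ := (hS.inter (measurableSet_le hpm measurable_const)).exists_lt_isCompact
    (pos_iff_ne_zero.2 hL)
  have hFm := hF.measurableSet
  have hne : F.Nonempty := nonempty_of_measure_ne_zero hF0.ne'
  refine ⟨F, fun z hz ↦ (hFS hz).1, hF, ProbabilityTheory.cond μ F,
    ProbabilityTheory.cond_isProbabilityMeasure hF0.ne', ?_, ?_⟩
  · rw [ProbabilityTheory.cond_apply hFm]
    simp
  set C : ENNReal := (μ F)⁻¹ * (L + ENNReal.ofReal (Real.log 2) * μ F) with hC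
  have hCtop : C ≠ ⊤ := ENNReal.mul_ne_top (ENNReal.inv_ne_top.2 hF0.ne')
    (ENNReal.add_ne_top.2 ⟨ENNReal.natCast_ne_top _,
      ENNReal.mul_ne_top ENNReal.ofReal_ne_top (measure_ne_top _ _)⟩)
  refine ⟨C.toNNReal, fun r ↦ ?_⟩
  rw [ENNReal.coe_toNNReal hCtop]
  obtain ⟨r', hr', hmin⟩ := hF.exists_infDist_eq_dist hne r
  have hker : ∀ w ∈ F, logKernel r w ≤ logKernel r' w + ENNReal.ofReal (Real.log 2) := by
    intro w hw
    apply logKernel_le_add_log_two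
    have h1 : dist r r' ≤ dist r w := hmin ▸ Metric.infDist_le_dist_of_mem hw
    have h2 : dist r' w ≤ dist r' r + dist r w := dist_triangle _ _ _
    rw [dist_comm r' r] at h2
    rw [← dist_eq_norm, ← dist_eq_norm]
    linarith
  rw [ProbabilityTheory.cond, lintegral_smul_measure, smul_eq_mul, hC]
  gcongr
  calc ∫⁻ w in F, logKernel r w ∂μ
      ≤ ∫⁻ w in F, (logKernel r' w + ENNReal.ofReal (Real.log 2)) ∂μ :=
        setLIntegral_mono' hFm hker
    _ = ∫⁻ w in F, logKernel r' w ∂μ + ENNReal.ofReal (Real.log 2) * μ F := by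
        rw [lintegral_add_left (measurable_logKernel_right r'), setLIntegral_const]
    _ ≤ L + ENNReal.ofReal (Real.log 2) * μ F := by
        gcongr
        exact (setLIntegral_le_lintegral F _).trans (hFS hr').2

lemma measurable_sum_logKernel (s : Multiset ℂ) :
    Measurable fun w ↦ (s.map fun r ↦ logKernel r w).sum := by
  induction s using Multiset.induction_on with
  | empty => simp
  | cons r s ih =>
    simp only [Multiset.map_cons, Multiset.sum_cons]
    exact (measurable_logKernel_right r).add ih

lemma lintegral_sum_logKernel_le {ν : Measure ℂ} {C : NNReal}
    (hC : ∀ r, ∫⁻ w, logKernel r w ∂ν ≤ C) (s : Multiset ℂ) :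
    ∫⁻ w, (s.map fun r ↦ logKernel r w).sum ∂ν ≤ s.card * C := by
  induction s using Multiset.induction_on with
  | empty => simp
  | cons r s ih =>
    simp only [Multiset.map_cons, Multiset.sum_cons, Multiset.card_cons]
    rw [lintegral_add_left (measurable_logKernel_right r), Nat.cast_add_one, add_mul, one_mul,
      add_comm]
    exact add_le_add ih (hC r)

lemma norm_sub_le_mul_exp_logKernel {B : ℝ} {t w r : ℂ} (hB : ‖t - w‖ ≤ B)
    (h : logKernel r w ≠ ⊤) :
    ‖t - r‖ ≤ ‖w - r‖ * (1 + B) * Real.exp (logKernel r w).toReal := by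
  have hB0 : 0 ≤ B := (norm_nonneg _).trans hB
  unfold logKernel at h ⊢
  split_ifs at h ⊢ with hrw
  · exact absurd rfl h
  have hx : 0 < ‖w - r‖ := norm_pos_iff.2 (sub_ne_zero.2 (Ne.symm hrw))
  rw [norm_sub_rev r w, ENNReal.toReal_ofReal', mul_right_comm]
  set x := ‖w - r‖
  set e := Real.exp (max (-Real.log x) 0)
  have h1 : 1 ≤ x * e := by
    have : Real.exp (-Real.log x) ≤ e := Real.exp_le_exp.2 (le_max_left _ _)
    rw [Real.exp_neg, Real.exp_log hx] at this
    calc 1 = x * x⁻¹ := (mul_inv_cancel₀ hx.ne').symm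
      _ ≤ x * e := by gcongr
  have h2 : x ≤ x * e :=
    le_mul_of_one_le_right hx.le (Real.one_le_exp (le_max_right _ _))
  have h3 : ‖t - r‖ ≤ ‖t - w‖ + x := norm_sub_le_norm_sub_add_norm_sub _ _ _
  nlinarith [mul_le_mul_of_nonneg_right h1 hB0]

lemma prod_norm_sub_le {B : ℝ} {t w : ℂ} (hB : ‖t - w‖ ≤ B) (s : Multiset ℂ)
    (h : (s.map fun r ↦ logKernel r w).sum ≠ ⊤) :
    (s.map fun r ↦ ‖t - r‖).prod ≤ (s.map fun r ↦ ‖w - r‖).prod * (1 + B) ^ s.card *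
      Real.exp (s.map fun r ↦ logKernel r w).sum.toReal := by
  have hB0 : 0 ≤ B := (norm_nonneg _).trans hB
  induction s using Multiset.induction_on with
  | empty => simp
  | cons r s ih =>
    simp only [Multiset.map_cons, Multiset.sum_cons, Multiset.card_cons, Multiset.prod_cons] at h ⊢
    obtain ⟨h1, h2⟩ := ENNReal.add_ne_top.1 h
    rw [ENNReal.toReal_add h1 h2, Real.exp_add, pow_succ]
    have hs : 0 ≤ (s.map fun r ↦ ‖t - r‖).prod := Multiset.prod_nonneg (by simp)
    calc _ ≤ _ := mul_le_mul (norm_sub_le_mul_exp_logKernel hB h1) (ih h2) hs (by positivity)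
      _ = _ := by ring

/-- A Bernstein–Walsh inequality: a compact set carrying a probability measure with bounded
potential controls the growth of polynomials at any point `t`, geometrically in the degree. The
ratio `‖P t‖ / ‖P w‖` is a product over the roots `r` of `P`, each factor being at most
`A * exp (logKernel r w)`; averaging over `w` gives a point where the product is small. -/
lemma exists_norm_eval_le_mul_pow {F : Set ℂ} (hF : IsCompact F) {ν : Measure ℂ}
    [IsProbabilityMeasure ν] (hν : ν Fᶜ = 0) {C : NNReal}
    (hC : ∀ r, ∫⁻ w, logKernel r w ∂ν ≤ C) (t : ℂ) :
    ∃ A : ℝ, 1 ≤ A ∧ ∀ (P : Polynomial ℂ) (m : ℝ), (∀ w ∈ F, ‖P.eval w‖ ≤ m) →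
      ‖P.eval t‖ ≤ m * A ^ P.natDegree := by
  obtain ⟨B, hB0, hB⟩ : ∃ B : ℝ, 0 ≤ B ∧ ∀ w ∈ F, ‖t - w‖ ≤ B := by
    obtain ⟨B, hB⟩ := (hF.image (f := fun w ↦ t - w) (by fun_prop)).isBounded.exists_norm_le
    exact ⟨max B 0, le_max_right _ _,
      fun w hw ↦ (hB _ (Set.mem_image_of_mem _ hw)).trans (le_max_left _ _)⟩
  refine ⟨(1 + B) * Real.exp C,
    one_le_mul_of_one_le_of_one_le (by linarith) (Real.one_le_exp C.2), fun P m hm ↦ ?_⟩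
  obtain ⟨w, hwF, hw⟩ := exists_notMem_null_le_lintegral (μ := ν)
    (measurable_sum_logKernel P.roots).aemeasurable hν
  rw [Set.notMem_compl_iff] at hwF
  replace hw := hw.trans (lintegral_sum_logKernel_le hC P.roots)
  have hcard : P.roots.card = P.natDegree := (IsAlgClosed.splits P).natDegree_eq_card_roots.symm
  have hfac : ∀ z, ‖P.eval z‖ = ‖P.leadingCoeff‖ * (P.roots.map fun r ↦ ‖z - r‖).prod := by
    intro z
    rw [(IsAlgClosed.splits P).eval_eq_prod_roots, norm_mul]
    congr 1
    induction P.roots using Multiset.induction_on with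
    | empty => simp
    | cons r s ih => simp [ih]
  have htop : (P.roots.card * C : ENNReal) ≠ ⊤ :=
    ENNReal.mul_ne_top (ENNReal.natCast_ne_top _) ENNReal.coe_ne_top
  have hprod := prod_norm_sub_le (hB w hwF) P.roots (ne_top_of_le_ne_top htop hw)
  have hexp : Real.exp (P.roots.map fun r ↦ logKernel r w).sum.toReal ≤
      Real.exp C ^ P.natDegree := by
    rw [← Real.exp_nat_mul, Real.exp_le_exp]
    have := ENNReal.toReal_mono htop hw
    simpa [hcard] using this
  have hQ : 0 ≤ (P.roots.map fun r ↦ ‖w - r‖).prod := by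
    refine Multiset.prod_nonneg fun a ha ↦ ?_
    obtain ⟨r, -, rfl⟩ := Multiset.mem_map.1 ha
    exact norm_nonneg _
  calc ‖P.eval t‖ = ‖P.leadingCoeff‖ * (P.roots.map fun r ↦ ‖t - r‖).prod := hfac t
    _ ≤ ‖P.leadingCoeff‖ * ((P.roots.map fun r ↦ ‖w - r‖).prod * (1 + B) ^ P.natDegree *
          Real.exp C ^ P.natDegree) := by
        rw [hcard] at hprod
        gcongr
        exact hprod.trans (by gcongr)
    _ = ‖P.eval w‖ * ((1 + B) * Real.exp C) ^ P.natDegree := by rw [hfac w, mul_pow]; ring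
    _ ≤ m * ((1 + B) * Real.exp C) ^ P.natDegree := by
        gcongr
        exact hm w hwF

/-- The plane is not polar: Lebesgue measure on the segment `[0, 1]` has finite energy. -/
lemma not_isPolar_univ : ¬ IsPolar Set.univ := by
  intro h
  have hlog : ∫⁻ u in Set.Icc (-1 : ℝ) 1, ENNReal.ofReal (-Real.log |u|) ≠ ⊤ := by
    have h1 : IntegrableOn (fun u : ℝ ↦ -Real.log |u|) (Set.Icc (-1 : ℝ) 1) := by
      simp only [Real.log_abs]
      exact ((intervalIntegrable_iff_integrableOn_Icc_of_le (by norm_num)).1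
        intervalIntegral.intervalIntegrable_log').neg
    exact (ne_of_lt (h1.lintegral_lt_top))
  set c := ∫⁻ u in Set.Icc (-1 : ℝ) 1, ENNReal.ofReal (-Real.log |u|)
  set I : Set ℝ := Set.Icc 0 1
  set μ : Measure ℂ := (volume.restrict I).map ((↑) : ℝ → ℂ)
  have hmeas : Measurable ((↑) : ℝ → ℂ) := Complex.measurable_ofReal
  have hint : ∀ x ∈ I, ∫⁻ w, logKernel x w ∂μ ≤ c := by
    intro x hx
    rw [lintegral_map (measurable_logKernel_right _) hmeas]
    calc ∫⁻ y in I, logKernel x y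
        = ∫⁻ y in I, ENNReal.ofReal (-Real.log |x - y|) := by
          refine lintegral_congr_ae (ae_restrict_of_ae ?_)
          have : ∀ᵐ y : ℝ, y ≠ x := by simp [ae_iff]
          filter_upwards [this] with y hy
          rw [logKernel, if_neg (by exact_mod_cast hy.symm), ← Complex.ofReal_sub,
            Complex.norm_real, Real.norm_eq_abs]
      _ ≤ ∫⁻ y in (fun y ↦ x - y) ⁻¹' Set.Icc (-1 : ℝ) 1, ENNReal.ofReal (-Real.log |x - y|) := by
          refine lintegral_mono_set fun y hy ↦ ?_
          simp only [I, Set.mem_Icc, Set.mem_preimage] at hx hy ⊢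
          constructor <;> linarith [hx.1, hx.2, hy.1, hy.2]
      _ = c := (Measure.measurePreserving_sub_left volume x).setLIntegral_comp_preimage
          measurableSet_Icc (f := fun u ↦ ENNReal.ofReal (-Real.log |u|)) (by fun_prop)
  have hμ : μ Set.univ = 1 := by
    rw [Measure.map_apply hmeas MeasurableSet.univ]
    simp [I]
  have : IsFiniteMeasure μ := ⟨by simp [hμ]⟩
  have := h (((↑) : ℝ → ℂ) '' I) (Set.subset_univ _)
    (isCompact_Icc.image Complex.continuous_ofReal) μ this
    (fun h0 ↦ by simp [h0] at hμ) (by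
      rw [Measure.map_apply hmeas
        (isCompact_Icc.image Complex.continuous_ofReal).measurableSet.compl]
      rw [Measure.restrict_apply (hmeas
        (isCompact_Icc.image Complex.continuous_ofReal).measurableSet.compl)]
      convert measure_empty (μ := (volume : Measure ℝ))
      ext x
      simp [I])
  have hle : ∫⁻ z, ∫⁻ w, logKernel z w ∂μ ∂μ ≤ c := by
    have hpot : Measurable fun z ↦ ∫⁻ w, logKernel z w ∂μ :=
      measurable_logKernel.lintegral_prod_right'
    rw [lintegral_map hpot hmeas]
    calc _ ≤ ∫⁻ x in I, c := setLIntegral_mono' measurableSet_Icc hint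
      _ = c := by simp [I]
  exact hlog (top_le_iff.1 (this ▸ hle))

/-! ### Formal composition and formal centralizers -/

section Formal

open PowerSeries

variable {R S : Type*} [CommRing R] [CommRing S]

/-- The composition `A (B (X))` of formal power series, meaningful when `B` has zero constant
coefficient: then `B ^ k` has order at least `k`, so the sum giving the coefficient of degree `n`
can be truncated at `k = n`. -/
noncomputable def formalComp (A B : R⟦X⟧) : R⟦X⟧ :=
  PowerSeries.mk fun n ↦ ∑ k ∈ Finset.range (n + 1), coeff k A * coeff n (B ^ k)

lemma map_formalComp (e : R →+* S) (A B : R⟦X⟧) :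
    PowerSeries.map e (formalComp A B) =
      formalComp (PowerSeries.map e A) (PowerSeries.map e B) := by
  ext n
  simp [formalComp, ← map_pow]

lemma coeff_pow_eq_zero {B : R⟦X⟧} (hB : coeff 0 B = 0) {k n : ℕ} (h : n < k) :
    coeff n (B ^ k) = 0 := by
  have h1 : (X : R⟦X⟧) ∣ B := X_dvd_iff.2 (by simpa using hB)
  exact X_pow_dvd_iff.1 (pow_dvd_pow_of_dvd h1 k) n h

lemma coeff_pow_self {B : R⟦X⟧} (hB : coeff 0 B = 0) (n : ℕ) :
    coeff n (B ^ n) = coeff 1 B ^ n := by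
  obtain ⟨Q, rfl⟩ : (X : R⟦X⟧) ∣ B := X_dvd_iff.2 (by simpa using hB)
  have h1 : coeff 1 (X * Q) = coeff 0 Q := coeff_succ_X_mul 0 Q
  have h2 := coeff_X_pow_mul (Q ^ n) n 0
  rw [h1, mul_pow]
  simpa using h2

/-- For `k ≥ 2`, the coefficient of degree `n` of `A ^ k` only depends on the coefficients of `A`
of degree less than `n`. -/
lemma coeff_pow_congr {A B : R⟦X⟧} (hA : coeff 0 A = 0) (hB : coeff 0 B = 0) {n k : ℕ}
    (h : ∀ j < n, coeff j A = coeff j B) (hk : 2 ≤ k) :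
    coeff n (A ^ k) = coeff n (B ^ k) := by
  have hXA : (X : R⟦X⟧) ∣ A := X_dvd_iff.2 (by simpa using hA)
  have hXB : (X : R⟦X⟧) ∣ B := X_dvd_iff.2 (by simpa using hB)
  have h1 : (X : R⟦X⟧) ∣ ∑ i ∈ Finset.range k, A ^ i * B ^ (k - 1 - i) := by
    refine Finset.dvd_sum fun i hi ↦ ?_
    rcases Nat.eq_zero_or_pos i with rfl | hi0
    · exact (dvd_pow hXB (by omega)).mul_left _
    · exact (dvd_pow hXA hi0.ne').mul_right _
  have h2 : (X : R⟦X⟧) ^ n ∣ A - B :=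
    X_pow_dvd_iff.2 fun m hm ↦ by simp [h m hm]
  have h3 : (X : R⟦X⟧) ^ (n + 1) ∣ A ^ k - B ^ k := by
    rw [← (Commute.all A B).geom_sum₂_mul, mul_comm, pow_succ]
    exact mul_dvd_mul h2 h1
  have := X_pow_dvd_iff.1 h3 n (Nat.lt_succ_self n)
  rwa [map_sub, sub_eq_zero] at this

lemma coeff_zero_formalComp {A B : R⟦X⟧} (hA : coeff 0 A = 0) :
    coeff 0 (formalComp A B) = 0 := by
  have : constantCoeff A = 0 := by simpa using hA
  simp [formalComp, this]

lemma coeff_one_formalComp (A B : R⟦X⟧) :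
    coeff 1 (formalComp A B) = coeff 1 A * coeff 1 B := by
  simp [formalComp, Finset.sum_range_succ, coeff_one]

/-- In the coefficient of degree `n ≥ 2` of `A ∘ B`, the top term of `A` and the linear term of
`A` are isolated. -/
lemma coeff_formalComp {A B : R⟦X⟧} (hA : coeff 0 A = 0) (hB : coeff 0 B = 0) {n : ℕ}
    (hn : 2 ≤ n) :
    coeff n (formalComp A B) = coeff 1 A * coeff n B +
      ∑ k ∈ Finset.Ico 2 n, coeff k A * coeff n (B ^ k) + coeff n A * coeff 1 B ^ n := by
  rw [formalComp, coeff_mk, Finset.sum_range_succ, coeff_pow_self hB,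
    Finset.range_eq_Ico, ← Finset.sum_Ico_consecutive _ (Nat.zero_le 2) hn]
  simp [Finset.sum_range_succ, hA]

/-- The commutation relation in degree `n ≥ 2`, solved for the coefficient of degree `n` of `G`:
the remaining terms only involve coefficients of `G` of smaller degree. -/
lemma coeff_formalComp_eq_iff {F G : R⟦X⟧} (hF : coeff 0 F = 0) (hG : coeff 0 G = 0) {n : ℕ}
    (hn : 2 ≤ n) :
    coeff n (formalComp G F) = coeff n (formalComp F G) ↔
      (coeff 1 F ^ n - coeff 1 F) * coeff n G =
        ∑ k ∈ Finset.Ico 2 n, coeff k F * coeff n (G ^ k) + coeff n F * coeff 1 G ^ n -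
          (coeff 1 G * coeff n F + ∑ k ∈ Finset.Ico 2 n, coeff k G * coeff n (F ^ k)) := by
  rw [coeff_formalComp hG hF hn, coeff_formalComp hF hG hn, ← sub_eq_zero,
    ← sub_eq_zero (a := (coeff 1 F ^ n - coeff 1 F) * coeff n G)]
  apply Eq.congr_left
  ring

/-- A formal power series commuting with `F` is determined by its multiplier, provided that the
multiplier `l` of `F` satisfies the nonresonance condition. -/
lemma eq_of_formalComp_comm {K : Type*} [Field K] {F G H : K⟦X⟧}
    (hF : coeff 0 F = 0) (hl : ∀ n, 2 ≤ n → coeff 1 F ^ n - coeff 1 F ≠ 0)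
    (hG : coeff 0 G = 0) (hH : coeff 0 H = 0) (h1 : coeff 1 G = coeff 1 H)
    (hGF : formalComp G F = formalComp F G) (hHF : formalComp H F = formalComp F H) :
    G = H := by
  ext n
  induction n using Nat.strong_induction_on with
  | _ n ih =>
    rcases lt_or_ge n 2 with hn | hn
    · interval_cases n
      · rw [hG, hH]
      · exact h1
    have eG := (coeff_formalComp_eq_iff hF hG hn).1 (by rw [hGF])
    have eH := (coeff_formalComp_eq_iff hF hH hn).1 (by rw [hHF])
    apply mul_left_cancel₀ (hl n hn)
    have e1 : ∑ k ∈ Finset.Ico 2 n, coeff k F * coeff n (G ^ k) =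
        ∑ k ∈ Finset.Ico 2 n, coeff k F * coeff n (H ^ k) :=
      Finset.sum_congr rfl fun k hk ↦ by
        rw [coeff_pow_congr hG hH ih (Finset.mem_Ico.1 hk).1]
    have e2 : ∑ k ∈ Finset.Ico 2 n, coeff k G * coeff n (F ^ k) =
        ∑ k ∈ Finset.Ico 2 n, coeff k H * coeff n (F ^ k) :=
      Finset.sum_congr rfl fun k hk ↦ by rw [ih k (Finset.mem_Ico.1 hk).2]
    rw [eG, eH, h1, e1, e2]

/-- The coefficients of the formal power series with multiplier `m` commuting with `F`. The
parameter `s n` stands for the inverse of `l ^ n - l`, with `l` the multiplier of `F`. -/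
noncomputable def commCoeff (F : R⟦X⟧) (s : ℕ → R) (m : R) (n : ℕ) : R :=
  if n = 0 then 0 else if n = 1 then m else
    s n * (∑ k ∈ Finset.Ico 2 n,
          coeff k F * coeff n (PowerSeries.mk
            (fun j ↦ if _h : j < n then commCoeff F s m j else 0) ^ k) +
        coeff n F * m ^ n -
      (m * coeff n F +
        ∑ k ∈ (Finset.Ico 2 n).attach, commCoeff F s m k * coeff n (F ^ (k : ℕ))))
termination_by n
decreasing_by
  · exact _h
  · exact (Finset.mem_Ico.1 k.2).2

/-- The formal power series with multiplier `m` commuting with `F`. -/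
noncomputable def commSeries (F : R⟦X⟧) (s : ℕ → R) (m : R) : R⟦X⟧ := PowerSeries.mk (commCoeff F s m)

lemma coeff_zero_commSeries (F : R⟦X⟧) (s : ℕ → R) (m : R) :
    coeff 0 (commSeries F s m) = 0 := by
  rw [commSeries, coeff_mk, commCoeff]
  simp

lemma coeff_one_commSeries (F : R⟦X⟧) (s : ℕ → R) (m : R) :
    coeff 1 (commSeries F s m) = m := by
  rw [commSeries, coeff_mk, commCoeff]
  simp

lemma coeff_commSeries (F : R⟦X⟧) (s : ℕ → R) (m : R) {n : ℕ} (hn : 2 ≤ n) :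
    coeff n (commSeries F s m) =
      s n * (∑ k ∈ Finset.Ico 2 n, coeff k F * coeff n (commSeries F s m ^ k) +
          coeff n F * m ^ n -
        (m * coeff n F +
          ∑ k ∈ Finset.Ico 2 n, coeff k (commSeries F s m) * coeff n (F ^ k))) := by
  conv_lhs => rw [commSeries, coeff_mk, commCoeff, if_neg (by omega), if_neg (by omega)]
  rw [Finset.sum_attach (Finset.Ico 2 n) fun k ↦ commCoeff F s m k * coeff n (F ^ k)]
  congr 2
  · congr 1
    refine Finset.sum_congr rfl fun k hk ↦ ?_
    congr 1
    refine coeff_pow_congr ?_ (coeff_zero_commSeries F s m) (fun j hj ↦ ?_)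
      (Finset.mem_Ico.1 hk).1
    · rw [coeff_mk, dif_pos (by omega), commCoeff]
      simp
    · rw [coeff_mk, dif_pos hj, commSeries, coeff_mk]
  · simp [commSeries]

lemma formalComp_commSeries {F : R⟦X⟧} (hF : coeff 0 F = 0) {s : ℕ → R}
    (hs : ∀ n, 2 ≤ n → (coeff 1 F ^ n - coeff 1 F) * s n = 1) (m : R) :
    formalComp (commSeries F s m) F = formalComp F (commSeries F s m) := by
  have hG := coeff_zero_commSeries F s m
  ext n
  rcases lt_or_ge n 2 with hn | hn
  · interval_cases n
    · rw [coeff_zero_formalComp hG, coeff_zero_formalComp hF]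
    · rw [coeff_one_formalComp, coeff_one_formalComp, mul_comm]
  · rw [coeff_formalComp_eq_iff hF hG hn, coeff_commSeries F s m hn, ← mul_assoc, hs n hn, one_mul,
      coeff_one_commSeries]

/-! ### Degrees of the coefficients -/

/-- The polynomials `p` with `deg p + e ≤ m` (or `p = 0`). -/
def degreeAddLE (R : Type*) [CommRing R] (e m : ℕ) : Submodule R (Polynomial R) where
  carrier := {p | ∀ i, m < i + e → p.coeff i = 0}
  add_mem' hp hq i hi := by simp [hp i hi, hq i hi]
  zero_mem' i _ := by simp
  smul_mem' c p hp i hi := by simp [hp i hi]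

lemma mul_mem_degreeAddLE {p q : Polynomial R} {e e' m m' : ℕ} (hp : p ∈ degreeAddLE R e m)
    (hq : q ∈ degreeAddLE R e' m') : p * q ∈ degreeAddLE R (e + e') (m + m') := by
  intro i hi
  rw [Polynomial.coeff_mul]
  refine Finset.sum_eq_zero fun x hx ↦ ?_
  have := Finset.HasAntidiagonal.mem_antidiagonal.1 hx
  rcases lt_or_ge m (x.1 + e) with h | h
  · rw [hp _ h, zero_mul]
  · rw [hq _ (by omega), mul_zero]

lemma mem_degreeAddLE_of_le {p : Polynomial R} {e e' m m' : ℕ} (hp : p ∈ degreeAddLE R e m)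
    (h : m + e' ≤ m' + e) : p ∈ degreeAddLE R e' m' :=
  fun i hi ↦ hp i (by omega)

/-- A power series over `R[t]` has weight `k` if its coefficient of degree `n` has degree at most
`d * (n - k)` in `t`, and vanishes for `n < k` when `d ≠ 0`. -/
def HasWeight (d k : ℕ) (A : (Polynomial R)⟦X⟧) : Prop :=
  ∀ n, coeff n A ∈ degreeAddLE R (d * k) (d * n)

lemma C_mem_degreeAddLE (c : R) : Polynomial.C c ∈ degreeAddLE R 0 0 :=
  fun i hi ↦ Polynomial.coeff_C_of_ne_zero (by omega)

lemma HasWeight.mul {d k l : ℕ} {A B : (Polynomial R)⟦X⟧} (hA : HasWeight d k A)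
    (hB : HasWeight d l B) : HasWeight d (k + l) (A * B) := by
  intro n
  rw [coeff_mul]
  refine Submodule.sum_mem _ fun x hx ↦ ?_
  rw [← Finset.HasAntidiagonal.mem_antidiagonal.1 hx, mul_add, mul_add]
  exact mul_mem_degreeAddLE (hA _) (hB _)

lemma HasWeight.pow {d : ℕ} {A : (Polynomial R)⟦X⟧} (hA : HasWeight d 1 A) (k : ℕ) :
    HasWeight d k (A ^ k) := by
  induction k with
  | zero =>
    intro n
    rw [pow_zero, coeff_one]
    split_ifs
    · exact mem_degreeAddLE_of_le (C_mem_degreeAddLE 1) (by omega)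
    · exact Submodule.zero_mem _
  | succ k ih => exact pow_succ A k ▸ ih.mul hA

/-- If `F` has weight `1` and its resonance factors and the multiplier `m` do not depend on `t`,
then the series commuting with `F` has weight `1`: its coefficient of degree `n` has degree at most
`d * (n - 1)` in `t`. -/
lemma hasWeight_commSeries {d : ℕ} {F : (Polynomial R)⟦X⟧} (hF : HasWeight d 1 F) (s : ℕ → R)
    (m : R) : HasWeight d 1 (commSeries F (fun n ↦ Polynomial.C (s n)) (Polynomial.C m)) := by
  set G := commSeries F (fun n ↦ Polynomial.C (s n)) (Polynomial.C m) with hG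
  intro n
  induction n using Nat.strong_induction_on with
  | _ n ih =>
    rcases lt_or_ge n 2 with hn | hn
    · interval_cases n
      · rw [hG, coeff_zero_commSeries]
        exact Submodule.zero_mem _
      · rw [hG, coeff_one_commSeries]
        exact mem_degreeAddLE_of_le (C_mem_degreeAddLE m) (by omega)
    have hpow : ∀ k, 2 ≤ k → coeff n (G ^ k) ∈ degreeAddLE R (d * k) (d * n) := by
      intro k hk
      -- the truncation of `G` below degree `n` has weight `1` by the induction hypothesis
      set G' : (Polynomial R)⟦X⟧ := PowerSeries.mk fun j ↦ if j < n then coeff j G else 0 with hG'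
      have hw : HasWeight d 1 G' := by
        intro j
        rw [hG', coeff_mk]
        split_ifs with hj
        · exact ih j hj
        · exact Submodule.zero_mem _
      have hG0 : coeff 0 G = 0 := coeff_zero_commSeries _ _ _
      rw [coeff_pow_congr (B := G') hG0 (by rw [hG', coeff_mk, if_pos (by omega), hG0])
        (fun j hj ↦ by rw [hG', coeff_mk, if_pos hj]) hk]
      exact hw.pow k n
    rw [hG, coeff_commSeries F _ _ hn, ← hG, ← Polynomial.C_pow]
    refine mem_degreeAddLE_of_le (mul_mem_degreeAddLE (C_mem_degreeAddLE (s n))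
      (Submodule.sub_mem (degreeAddLE R (d * 1) (d * n)) (Submodule.add_mem _
        (Submodule.sum_mem _ fun k hk ↦ ?_) ?_)
        (Submodule.add_mem _ ?_ (Submodule.sum_mem _ fun k hk ↦ ?_)))) (by omega)
    · exact mem_degreeAddLE_of_le
        (mul_mem_degreeAddLE (hF k) (hpow k (Finset.mem_Ico.1 hk).1)) (by omega)
    · exact mem_degreeAddLE_of_le (mul_mem_degreeAddLE (hF n) (C_mem_degreeAddLE _)) (by omega)
    · exact mem_degreeAddLE_of_le (mul_mem_degreeAddLE (C_mem_degreeAddLE _) (hF n)) (by omega)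
    · exact mem_degreeAddLE_of_le
        (mul_mem_degreeAddLE (ih k (Finset.mem_Ico.1 hk).2) (hF.pow k n)) (by omega)

lemma HasWeight.natDegree_le {d : ℕ} {A : (Polynomial R)⟦X⟧} (hA : HasWeight d 1 A) (n : ℕ) :
    (coeff n A).natDegree ≤ d * n :=
  Polynomial.natDegree_le_iff_coeff_eq_zero.2 fun i hi ↦ hA n i (by omega)

end Formal

/-! ### Taylor expansions of germs -/

section Expansion

open Asymptotics PowerSeries

lemma isBigO_pow_pow_of_le {m n : ℕ} (h : m ≤ n) :
    (fun z : ℂ ↦ z ^ n) =O[𝓝 0] fun z : ℂ ↦ z ^ m := by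
  rcases h.eq_or_lt with rfl | h
  · exact isBigO_refl _ _
  · exact (isLittleO_pow_pow h).isBigO

lemma not_isBigO_pow_mul {g : ℂ → ℂ} (hg : ContinuousAt g 0) (hg0 : g 0 ≠ 0) (n : ℕ) :
    ¬ (fun z : ℂ ↦ z ^ n * g z) =O[𝓝 0] fun z : ℂ ↦ z ^ (n + 1) := by
  intro h
  have h1 : (fun z ↦ (g z)⁻¹) =O[𝓝 0] fun _ : ℂ ↦ (1 : ℂ) :=
    (hg.tendsto.inv₀ hg0).isBigO_one ℂ
  have h2 : (fun z : ℂ ↦ z ^ n) =O[𝓝 0] fun z : ℂ ↦ z ^ (n + 1) := by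
    refine ((h.mul h1).congr' ?_ (by simp))
    filter_upwards [hg.eventually_ne hg0] with z hz
    field_simp
  have h3 : ∃ᶠ z : ℂ in 𝓝[≠] 0, z ^ n ≠ 0 := by
    refine Eventually.frequently (eventually_mem_nhdsWithin.mono fun z hz ↦ ?_)
    exact pow_ne_zero n hz
  exact isLittleO_irrefl (h3.filter_mono nhdsWithin_le_nhds)
    (h2.trans_isLittleO (isLittleO_pow_pow n.lt_succ_self))

lemma isBigO_pow_iff_X_pow_dvd {p : Polynomial ℂ} {n : ℕ} :
    (fun z ↦ p.eval z) =O[𝓝 0] (fun z : ℂ ↦ z ^ n) ↔ Polynomial.X ^ n ∣ p := by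
  constructor
  · intro h
    induction n with
    | zero => simp
    | succ n ih =>
      obtain ⟨q, rfl⟩ := ih (h.trans (isBigO_pow_pow_of_le n.le_succ))
      rw [pow_succ]
      refine mul_dvd_mul_left _ (Polynomial.X_dvd_iff.2 ?_)
      rw [Polynomial.coeff_zero_eq_eval_zero]
      by_contra hq
      exact not_isBigO_pow_mul q.continuous.continuousAt hq n (by simpa using h)
  · rintro ⟨q, rfl⟩
    have hq : (fun z ↦ q.eval z) =O[𝓝 0] fun _ : ℂ ↦ (1 : ℂ) :=
      (q.continuous.tendsto 0).isBigO_one ℂ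
    simpa using (isBigO_refl (fun z : ℂ ↦ z ^ n) (𝓝 0)).mul hq

/-- `A` is the (asymptotic) Taylor expansion of `f` at `0`; analyticity of `f` is not required. -/
def HasExpansion (f : ℂ → ℂ) (A : ℂ⟦X⟧) : Prop :=
  ∀ n, (fun z ↦ f z - (trunc n A).eval z) =O[𝓝 0] fun z : ℂ ↦ z ^ n

variable {f g : ℂ → ℂ} {A B : ℂ⟦X⟧}

lemma hasExpansion_of_forall_exists
    (h : ∀ n, ∃ p : Polynomial ℂ, (∀ m < n, p.coeff m = coeff m A) ∧
      (fun z ↦ f z - p.eval z) =O[𝓝 0] fun z : ℂ ↦ z ^ n) : HasExpansion f A := by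
  intro n
  obtain ⟨p, hp, hfp⟩ := h n
  have h1 : Polynomial.X ^ n ∣ p - trunc n A := by
    refine Polynomial.X_pow_dvd_iff.2 fun m hm ↦ ?_
    rw [Polynomial.coeff_sub, coeff_trunc, if_pos hm, hp m hm, sub_self]
  refine (hfp.add (isBigO_pow_iff_X_pow_dvd.2 h1)).congr_left fun z ↦ ?_
  simp

lemma HasExpansion.coeff_eq_zero (h : HasExpansion f A) {n : ℕ}
    (hf : f =O[𝓝 0] fun z : ℂ ↦ z ^ n) {m : ℕ} (hm : m < n) : coeff m A = 0 := by
  have h1 : (fun z ↦ (trunc n A).eval z) =O[𝓝 0] fun z : ℂ ↦ z ^ n :=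
    (hf.sub (h n)).congr_left fun z ↦ by simp
  have := Polynomial.X_pow_dvd_iff.1 (isBigO_pow_iff_X_pow_dvd.1 h1) m hm
  rwa [coeff_trunc, if_pos hm] at this

lemma HasExpansion.isBigO_id (h : HasExpansion f A) (hA : coeff 0 A = 0) :
    f =O[𝓝 0] fun z : ℂ ↦ z := by
  have hA' : constantCoeff A = 0 := by simpa using hA
  simpa [hA'] using h 1

lemma HasExpansion.add (hf : HasExpansion f A) (hg : HasExpansion g B) :
    HasExpansion (fun z ↦ f z + g z) (A + B) := fun n ↦
  ((hf n).add (hg n)).congr_left fun z ↦ by simp; ring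

lemma HasExpansion.sub (hf : HasExpansion f A) (hg : HasExpansion g B) :
    HasExpansion (fun z ↦ f z - g z) (A - B) := fun n ↦
  ((hf n).sub (hg n)).congr_left fun z ↦ by simp; ring

lemma HasExpansion.eq (hf : HasExpansion f A) (hg : HasExpansion g B) (h : f =ᶠ[𝓝 0] g) :
    A = B := by
  rw [← sub_eq_zero]
  ext n
  have h0 : (fun z ↦ f z - g z) =ᶠ[𝓝 0] fun _ ↦ 0 := h.mono fun z hz ↦ by simp [hz]
  exact (hf.sub hg).coeff_eq_zero (n := n + 1)
    (h0.trans_isBigO (isBigO_zero _ _)) n.lt_succ_self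

lemma hasExpansion_eval (p : Polynomial ℂ) : HasExpansion (fun z ↦ p.eval z) (p : ℂ⟦X⟧) :=
  hasExpansion_of_forall_exists fun n ↦
    ⟨p, fun m _ ↦ by simp, by simpa using isBigO_zero _ _⟩

lemma hasExpansion_const (c : ℂ) : HasExpansion (fun _ ↦ c) (PowerSeries.C c) := by
  simpa using hasExpansion_eval (Polynomial.C c)

lemma HasExpansion.mul (hf : HasExpansion f A) (hg : HasExpansion g B) :
    HasExpansion (fun z ↦ f z * g z) (A * B) := by
  refine hasExpansion_of_forall_exists fun n ↦ ⟨trunc n A * trunc n B, fun m hm ↦ ?_, ?_⟩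
  · rw [coeff_mul_eq_coeff_trunc_mul_trunc A B hm, ← Polynomial.coe_mul, Polynomial.coeff_coe]
  have hp : (fun z ↦ (trunc n A).eval z) =O[𝓝 0] fun _ : ℂ ↦ (1 : ℂ) :=
    ((trunc n A).continuous.tendsto 0).isBigO_one ℂ
  have hg1 : g =O[𝓝 0] fun _ : ℂ ↦ (1 : ℂ) := by
    simpa using hg 0
  have h1 := (hf n).mul hg1
  have h2 := hp.mul (hg n)
  simp only [mul_one, one_mul] at h1 h2
  refine (h1.add h2).congr_left fun z ↦ ?_
  rw [Polynomial.eval_mul]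
  ring

lemma HasExpansion.pow (hf : HasExpansion f A) (k : ℕ) :
    HasExpansion (fun z ↦ f z ^ k) (A ^ k) := by
  induction k with
  | zero => simpa using hasExpansion_const 1
  | succ k ih => simpa only [pow_succ] using ih.mul hf

lemma HasExpansion.sum {ι : Type*} (s : Finset ι) {f : ι → ℂ → ℂ} {A : ι → ℂ⟦X⟧}
    (h : ∀ i ∈ s, HasExpansion (f i) (A i)) :
    HasExpansion (fun z ↦ ∑ i ∈ s, f i z) (∑ i ∈ s, A i) := by
  induction s using Finset.cons_induction with
  | empty => simpa using hasExpansion_const 0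
  | cons i s hi ih =>
    simp only [Finset.sum_cons]
    exact (h i (Finset.mem_cons_self i s)).add
      (ih fun j hj ↦ h j (Finset.mem_cons_of_mem hj))

lemma HasExpansion.comp (hg : HasExpansion g A) (hf : HasExpansion f B) (hB : coeff 0 B = 0) :
    HasExpansion (g ∘ f) (formalComp A B) := by
  refine hasExpansion_of_forall_exists fun n ↦ ?_
  set D : ℂ⟦X⟧ := ∑ k ∈ Finset.range n, PowerSeries.C (coeff k A) * B ^ k with hD
  have hfO := hf.isBigO_id hB
  have hft : Tendsto f (𝓝 0) (𝓝 0) := hfO.trans_tendsto tendsto_id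
  have hexp : HasExpansion (fun z ↦ ∑ k ∈ Finset.range n, coeff k A * f z ^ k) D :=
    HasExpansion.sum _ fun k _ ↦ (hasExpansion_const _).mul (hf.pow k)
  refine ⟨trunc n D, fun m hm ↦ ?_, ?_⟩
  · rw [coeff_trunc, if_pos hm, hD, map_sum, formalComp, coeff_mk]
    simp only [coeff_C_mul]
    symm
    refine Finset.sum_subset (Finset.range_mono hm) fun k _ hk ↦ ?_
    rw [coeff_pow_eq_zero hB (by simpa [Nat.lt_succ_iff] using hk), mul_zero]
  · have h1 : (fun z ↦ g (f z) - (trunc n A).eval (f z)) =O[𝓝 0] fun z : ℂ ↦ z ^ n :=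
      ((hg n).comp_tendsto hft).trans (hfO.pow n)
    refine (h1.add (hexp n)).congr_left fun z ↦ ?_
    have : (trunc n A).eval (f z) = ∑ k ∈ Finset.range n, coeff k A * f z ^ k := by
      simpa [Polynomial.eval₂_id] using eval₂_trunc_eq_sum_range (f z) (RingHom.id ℂ) n A
    rw [this, Function.comp_apply]
    ring

lemma hasExpansion_of_hasFPowerSeriesAt {p : FormalMultilinearSeries ℂ ℂ ℂ}
    (h : HasFPowerSeriesAt f p 0) : HasExpansion f (PowerSeries.mk p.coeff) := by
  intro n
  have h1 := h.isBigO_sub_partialSum_pow n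
  simp only [zero_add, ← norm_pow] at h1
  refine h1.of_norm_right.congr_left fun z ↦ ?_
  have := eval₂_trunc_eq_sum_range z (RingHom.id ℂ) n (PowerSeries.mk p.coeff)
  rw [Polynomial.eval₂_id] at this
  rw [this, FormalMultilinearSeries.partialSum]
  congr 1
  exact Finset.sum_congr rfl fun k _ ↦ by simp [mul_comm]

/-- A power series has positive radius of convergence: its coefficients grow at most
geometrically. The bound is quantified over natural numbers, so that it defines a countable union
of closed conditions on the coefficients. -/
def IsConvergent (A : ℂ⟦X⟧) : Prop :=
  ∃ M : ℕ, ∀ n, ‖coeff n A‖ ≤ (M : ℝ) ^ (n + 1)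

lemma exists_hasExpansion (hf : AnalyticAt ℂ f 0) : ∃ A, HasExpansion f A ∧ IsConvergent A := by
  obtain ⟨p, hp⟩ := hf
  refine ⟨_, hasExpansion_of_hasFPowerSeriesAt hp, ?_⟩
  obtain ⟨C, r, hC, hr, h⟩ := p.le_mul_pow_of_radius_pos hp.radius_pos
  obtain ⟨M, hM⟩ := exists_nat_ge (max C r)
  refine ⟨M, fun n ↦ ?_⟩
  rw [coeff_mk, ← FormalMultilinearSeries.norm_apply_eq_norm_coef, pow_succ']
  refine (h n).trans ?_
  gcongr
  · exact (le_max_left _ _).trans hM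
  · exact (le_max_right _ _).trans hM

lemma IsConvergent.exists_analyticAt (hA : IsConvergent A) :
    ∃ f, AnalyticAt ℂ f 0 ∧ HasExpansion f A := by
  obtain ⟨M, hM⟩ := hA
  set p := FormalMultilinearSeries.ofScalars ℂ fun n ↦ coeff n A with hp
  have hr : 0 < p.radius := by
    have hM1 : (0 : ℝ) < M + 1 := by positivity
    refine lt_of_lt_of_le ?_ (p.le_radius_of_bound (r := ((M : NNReal) + 1)⁻¹) (M + 1) fun n ↦ ?_)
    · rw [ENNReal.coe_pos]
      positivity
    · rw [FormalMultilinearSeries.norm_apply_eq_norm_coef, hp,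
        FormalMultilinearSeries.coeff_ofScalars]
      push_cast
      rw [inv_pow, ← div_eq_mul_inv, div_le_iff₀ (by positivity), ← pow_succ']
      exact (hM n).trans (by gcongr; linarith)
  have h := (p.hasFPowerSeriesOnBall hr).hasFPowerSeriesAt
  refine ⟨_, h.analyticAt, ?_⟩
  convert hasExpansion_of_hasFPowerSeriesAt h
  ext n
  simp [hp]

lemma HasExpansion.apply_zero (h : HasExpansion f A) : f 0 = coeff 0 A := by
  have h1 := h 1
  have h2 : (fun z ↦ f z - coeff 0 A) =O[𝓝 (0 : ℂ)] fun z : ℂ ↦ ‖z - 0‖ ^ 1 := by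
    simpa [← isBigO_norm_right (g' := fun z : ℂ ↦ z)] using h1
  exact sub_eq_zero.1 (h2.eq_zero_of_norm_pow one_ne_zero)

lemma HasExpansion.deriv_zero (h : HasExpansion f A) : deriv f 0 = coeff 1 A := by
  refine HasDerivAt.deriv (hasDerivAt_iff_isLittleO.2 ?_)
  have h2 := (h 2).trans_isLittleO (isLittleO_pow_pow one_lt_two)
  simp only [pow_one] at h2
  rw [h.apply_zero]
  simp only [sub_zero, smul_eq_mul]
  refine h2.congr_left fun z ↦ ?_
  have := eval₂_trunc_eq_sum_range z (RingHom.id ℂ) 2 A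
  rw [Polynomial.eval₂_id] at this
  rw [this]
  simp [Finset.sum_range_succ]
  ring

lemma HasExpansion.eventually_eq_zero (hf : AnalyticAt ℂ f 0) (h : HasExpansion f 0) :
    ∀ᶠ z in 𝓝 0, f z = 0 := by
  by_contra hne
  obtain ⟨n, g, hg, hg0, hfg⟩ := hf.exists_eventuallyEq_pow_smul_nonzero_iff.2 hne
  refine not_isBigO_pow_mul hg.continuousAt hg0 n ?_
  have h1 : f =O[𝓝 0] fun z : ℂ ↦ z ^ (n + 1) := by simpa using h (n + 1)
  refine h1.congr' ?_ EventuallyEq.rfl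
  filter_upwards [hfg] with z hz
  simpa using hz

lemma HasExpansion.eventuallyEq (hf : AnalyticAt ℂ f 0) (hg : AnalyticAt ℂ g 0)
    (hfA : HasExpansion f A) (hgA : HasExpansion g A) : f =ᶠ[𝓝 0] g := by
  have h := hfA.sub hgA
  rw [sub_self] at h
  filter_upwards [h.eventually_eq_zero (hf.sub hg)] with z hz
  exact sub_eq_zero.1 hz

end Expansion

/-! ### Convergence sets of polynomial sequences -/

section ConvergenceSet

variable (b : ℕ → Polynomial ℂ)

/-- The set of parameters `t` for which the power series `∑ b n (t) * z ^ n` converges for some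
`z ≠ 0`. -/
def convergenceSet : Set ℂ := {t | ∃ M : ℕ, ∀ n, ‖(b n).eval t‖ ≤ (M : ℝ) ^ (n + 1)}

/-- The parameters for which the coefficients satisfy the geometric bound with ratio `M`. -/
def boundedSet (M : ℕ) : Set ℂ := {t | ∀ n, ‖(b n).eval t‖ ≤ (M : ℝ) ^ (n + 1)}

lemma measurableSet_boundedSet (M : ℕ) : MeasurableSet (boundedSet b M) := by
  simp only [boundedSet, Set.ofPred_forall]
  exact (isClosed_iInter fun n ↦
    isClosed_le (by fun_prop) continuous_const).measurableSet

lemma convergenceSet_eq_iUnion : convergenceSet b = ⋃ M, boundedSet b M := by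
  ext t
  simp [convergenceSet, boundedSet]

lemma measurableSet_convergenceSet : MeasurableSet (convergenceSet b) := by
  rw [convergenceSet_eq_iUnion]
  exact MeasurableSet.iUnion (measurableSet_boundedSet b)

variable {b}

/-- If the degrees grow at most linearly, the convergence set is polar or the whole plane: a
measure of finite energy on it charges some `boundedSet b M`, and the Bernstein–Walsh inequality
propagates the bound from there to every parameter. -/
lemma isPolar_convergenceSet_or {d : ℕ} (hb : ∀ n, (b n).natDegree ≤ d * n) :
    IsPolar (convergenceSet b) ∨ convergenceSet b = Set.univ := by
  refine or_iff_not_imp_left.2 fun hpol ↦ Set.eq_univ_of_forall fun t ↦ ?_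
  unfold IsPolar at hpol
  push Not at hpol
  obtain ⟨K, hKE, hK, μ, hμ, hμ0, hμK, hE⟩ := hpol
  obtain ⟨M, hM⟩ : ∃ M, μ (boundedSet b M) ≠ 0 := by
    by_contra! h
    have h1 : μ (convergenceSet b) = 0 := convergenceSet_eq_iUnion b ▸ measure_iUnion_null h
    refine hμ0 (Measure.measure_univ_eq_zero.1 ?_)
    rw [← Set.union_compl_self K]
    exact measure_union_null (measure_mono_null hKE h1) hμK
  obtain ⟨F, hFS, hF, ν, hν, hνF, C, hC⟩ :=
    exists_bounded_potential (measurableSet_boundedSet b M) hM hE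
  obtain ⟨A, hA, hbound⟩ := exists_norm_eval_le_mul_pow hF hνF hC t
  obtain ⟨N, hN⟩ := exists_nat_ge (M * A ^ d)
  refine ⟨N, fun n ↦ ?_⟩
  calc ‖(b n).eval t‖ ≤ (M : ℝ) ^ (n + 1) * A ^ (b n).natDegree :=
        hbound _ _ fun w hw ↦ hFS hw n
    _ ≤ (M : ℝ) ^ (n + 1) * A ^ (d * (n + 1)) := by
        gcongr
        exact (hb n).trans (Nat.mul_le_mul_left d n.le_succ)
    _ = (M * A ^ d) ^ (n + 1) := by rw [mul_pow, pow_mul]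
    _ ≤ (N : ℝ) ^ (n + 1) := by gcongr

end ConvergenceSet

/-! ### Rotation sets and formal centralizers -/

section Rotation

open PowerSeries

/-- A germ with nonresonant multiplier has a commuting germ with multiplier `G'(0)` exactly when
the formal solution `G` converges. -/
lemma exists_mem_centralizer_iff {f : ℂ → ℂ} {F G : ℂ⟦X⟧} (hf : AnalyticAt ℂ f 0)
    (hfF : HasExpansion f F) (hF : coeff 0 F = 0)
    (hl : ∀ n, 2 ≤ n → coeff 1 F ^ n - coeff 1 F ≠ 0) (hG : coeff 0 G = 0)
    (hG1 : coeff 1 G ≠ 0) (hGF : formalComp G F = formalComp F G) :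
    (∃ g ∈ centralizer f, deriv g 0 = coeff 1 G) ↔ IsConvergent G := by
  have hf0 : f 0 = 0 := hfF.apply_zero.trans hF
  constructor
  · rintro ⟨g, ⟨⟨hga, hg0, -⟩, hcomm⟩, hg1⟩
    obtain ⟨H, hgH, hH⟩ := exists_hasExpansion hga
    have hH0 : coeff 0 H = 0 := hgH.apply_zero.symm.trans hg0
    have hHF := (hgH.comp hfF hF).eq (hfF.comp hgH hH0) hcomm
    rwa [eq_of_formalComp_comm hF hl hG hH0 (hg1.symm.trans hgH.deriv_zero) hGF hHF]
  · intro h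
    obtain ⟨g, hga, hgG⟩ := h.exists_analyticAt
    have hg0 : g 0 = 0 := hgG.apply_zero.trans hG
    refine ⟨g, ⟨⟨hga, hg0, hgG.deriv_zero ▸ hG1⟩, ?_⟩, hgG.deriv_zero⟩
    refine HasExpansion.eventuallyEq (hga.comp_of_eq hf hf0) (hf.comp_of_eq hga hg0)
      (hgG.comp hfF hF) ?_
    rw [hGF]
    exact hfF.comp hgG hG

lemma exp_pow_sub_ne_zero {α : ℝ} (hα : Irrational α) {n : ℕ} (hn : 2 ≤ n) :
    Complex.exp (2 * Real.pi * Complex.I * α) ^ n -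
      Complex.exp (2 * Real.pi * Complex.I * α) ≠ 0 := by
  obtain ⟨m, rfl⟩ : ∃ m, n = m + 1 := ⟨n - 1, by omega⟩
  rw [pow_succ, ← sub_one_mul]
  refine mul_ne_zero (sub_ne_zero.2 fun h ↦ ?_) (Complex.exp_ne_zero _)
  rw [← Complex.exp_nat_mul, Complex.exp_eq_one_iff] at h
  obtain ⟨k, hk⟩ := h
  have h1 : ((m : ℂ) * α) * (2 * Real.pi * Complex.I) = k * (2 * Real.pi * Complex.I) := by
    rw [← hk]
    ring
  have h2 : (m : ℝ) * α = k := by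
    exact_mod_cast mul_right_cancel₀ Complex.two_pi_I_ne_zero h1
  exact (hα.natCast_mul (by omega : m ≠ 0)).ne_int k h2

/-- The family with coefficients `Φ i` of the nonlinear part, as a power series over the ring of
polynomials in the parameter. -/
noncomputable def familySeries (l : ℂ) {d : ℕ} (Φ : Fin (d + 1) → ℂ⟦X⟧) : (Polynomial ℂ)⟦X⟧ :=
  PowerSeries.C (Polynomial.C l) * PowerSeries.X +
    ∑ i : Fin (d + 1), PowerSeries.C (Polynomial.X ^ (i : ℕ)) *
      PowerSeries.map Polynomial.C (Φ i)

lemma map_familySeries (l : ℂ) {d : ℕ} (Φ : Fin (d + 1) → ℂ⟦X⟧) (t : ℂ) :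
    PowerSeries.map (Polynomial.evalRingHom t) (familySeries l Φ) =
      PowerSeries.C l * PowerSeries.X +
        ∑ i : Fin (d + 1), PowerSeries.C (t ^ (i : ℕ)) * Φ i := by
  have h : ∀ A : ℂ⟦X⟧,
      PowerSeries.map (Polynomial.evalRingHom t) (PowerSeries.map Polynomial.C A) = A := by
    intro A
    ext n
    simp
  simp [familySeries, h]

lemma coeff_zero_familySeries (l : ℂ) {d : ℕ} {Φ : Fin (d + 1) → ℂ⟦X⟧}
    (hΦ : ∀ i, ∀ n < 2, coeff n (Φ i) = 0) : coeff 0 (familySeries l Φ) = 0 := by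
  rw [familySeries, map_add, map_sum, coeff_C_mul, coeff_zero_X, mul_zero, zero_add]
  refine Finset.sum_eq_zero fun i _ ↦ ?_
  rw [coeff_C_mul, coeff_map, hΦ i 0 (by norm_num), map_zero, mul_zero]

lemma coeff_one_familySeries (l : ℂ) {d : ℕ} {Φ : Fin (d + 1) → ℂ⟦X⟧}
    (hΦ : ∀ i, ∀ n < 2, coeff n (Φ i) = 0) :
    coeff 1 (familySeries l Φ) = Polynomial.C l := by
  rw [familySeries, map_add, map_sum, coeff_C_mul, coeff_one_X, mul_one, add_eq_left]
  refine Finset.sum_eq_zero fun i _ ↦ ?_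
  rw [coeff_C_mul, coeff_map, hΦ i 1 (by norm_num), map_zero, mul_zero]

lemma hasWeight_familySeries (l : ℂ) {d : ℕ} {Φ : Fin (d + 1) → ℂ⟦X⟧}
    (hΦ : ∀ i, ∀ n < 2, coeff n (Φ i) = 0) : HasWeight d 1 (familySeries l Φ) := by
  intro n
  rcases lt_or_ge n 2 with hn | hn
  · interval_cases n
    · rw [coeff_zero_familySeries l hΦ]
      exact Submodule.zero_mem _
    · rw [coeff_one_familySeries l hΦ]
      exact mem_degreeAddLE_of_le (C_mem_degreeAddLE l) (by omega)
  rw [familySeries, map_add, map_sum, coeff_C_mul, coeff_X, if_neg (by omega), mul_zero, zero_add]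
  refine Submodule.sum_mem _ fun i _ j hj ↦ ?_
  have hd : d * 2 ≤ d * n := Nat.mul_le_mul_left d hn
  rw [coeff_C_mul, coeff_map, Polynomial.coeff_mul_C, Polynomial.coeff_X_pow,
    if_neg (by omega), zero_mul]

lemma hasExpansion_family (α : ℝ) {d : ℕ} {φ : Fin (d + 1) → ℂ → ℂ} {Φ : Fin (d + 1) → ℂ⟦X⟧}
    (hφ : ∀ i, HasExpansion (φ i) (Φ i)) (t : ℂ) :
    HasExpansion (family α d φ t) (PowerSeries.map (Polynomial.evalRingHom t)
      (familySeries (Complex.exp (2 * Real.pi * Complex.I * α)) Φ)) := by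
  rw [map_familySeries]
  refine HasExpansion.add ((hasExpansion_const _).mul ?_)
    (HasExpansion.sum _ fun i _ ↦ (hasExpansion_const _).mul (hφ i))
  simpa using hasExpansion_eval Polynomial.X

lemma analyticAt_family (α : ℝ) {d : ℕ} {φ : Fin (d + 1) → ℂ → ℂ}
    (hφ : ∀ i, AnalyticAt ℂ (φ i) 0) (t : ℂ) : AnalyticAt ℂ (family α d φ t) 0 :=
  (analyticAt_const.mul analyticAt_id).add
    (Finset.analyticAt_fun_sum _ fun i _ ↦ analyticAt_const.mul (hφ i))

/-- The parameters `t` for which `β` belongs to the rotation set of the family form the convergence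
set of a sequence of polynomials of linearly growing degrees. -/
lemma exists_mem_rotationSet_family_iff {α : ℝ} (hα : Irrational α) {d : ℕ}
    {φ : Fin (d + 1) → ℂ → ℂ} (hφ : ∀ i, AnalyticAt ℂ (φ i) 0)
    (hφ2 : ∀ i, φ i =O[𝓝 0] fun z : ℂ ↦ z ^ 2) (β : UnitAddCircle) :
    ∃ b : ℕ → Polynomial ℂ, (∀ n, (b n).natDegree ≤ d * n) ∧
      ∀ t, β ∈ rotationSet (family α d φ t) ↔ t ∈ convergenceSet b := by
  choose Φ hΦ _ using fun i ↦ exists_hasExpansion (hφ i)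
  have hΦ2 : ∀ i, ∀ n < 2, coeff n (Φ i) = 0 := fun i n hn ↦ (hΦ i).coeff_eq_zero (hφ2 i) hn
  set l := Complex.exp (2 * Real.pi * Complex.I * α) with hl
  set m : ℂ := (AddCircle.toCircle β : ℂ) with hm
  set F := familySeries l Φ with hF
  set s : ℕ → ℂ := fun n ↦ (l ^ n - l)⁻¹ with hs
  set G := commSeries F (fun n ↦ Polynomial.C (s n)) (Polynomial.C m) with hG
  have hF0 : coeff 0 F = 0 := coeff_zero_familySeries l hΦ2
  have hF1 : coeff 1 F = Polynomial.C l := coeff_one_familySeries l hΦ2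
  have hG0 : coeff 0 G = 0 := coeff_zero_commSeries _ _ _
  have hG1 : coeff 1 G = Polynomial.C m := coeff_one_commSeries _ _ _
  have hGF : formalComp G F = formalComp F G := by
    refine formalComp_commSeries hF0 (fun n hn ↦ ?_) _
    rw [hF1, ← Polynomial.C_pow, ← Polynomial.C_sub, ← Polynomial.C_mul, hs,
      mul_inv_cancel₀ (exp_pow_sub_ne_zero hα hn), Polynomial.C_1]
  refine ⟨fun n ↦ coeff n G,
    (hasWeight_commSeries (hasWeight_familySeries l hΦ2) s m).natDegree_le, fun t ↦ ?_⟩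
  set e := Polynomial.evalRingHom t with he
  have h1 : coeff 1 (PowerSeries.map e F) = l := by simp [hF1, he]
  have h2 : coeff 1 (PowerSeries.map e G) = m := by simp [hG1, he]
  have := exists_mem_centralizer_iff (analyticAt_family α hφ t) (hasExpansion_family α hΦ t)
    (G := PowerSeries.map e G) (by rw [coeff_map, ← hF, hF0, map_zero])
    (by rw [← he, ← hF, h1]; exact fun n hn ↦ exp_pow_sub_ne_zero hα hn)
    (by rw [coeff_map, hG0, map_zero]) (by rw [h2]; exact Circle.coe_ne_zero _)
    (by rw [← map_formalComp, ← map_formalComp, ← hF, hGF])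
  rw [h2] at this
  simpa [rotationSet, convergenceSet, IsConvergent, he] using this

end Rotation

end SmallDivisors

theorem theorem6 (α : ℝ) (hα : Irrational α) (d : ℕ) (φ : Fin (d + 1) → ℂ → ℂ)
    (hφ : ∀ i, AnalyticAt ℂ (φ i) 0) (hφ2 : ∀ i, φ i =O[𝓝 0] fun z : ℂ ↦ z ^ 2)
    (β : UnitAddCircle) :
    Xor (∀ t : ℂ, β ∈ SmallDivisors.rotationSet (SmallDivisors.family α d φ t))
      (∃ E : Set ℂ, MeasurableSet E ∧ SmallDivisors.IsPolar E ∧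
        ∀ t ∉ E, β ∉ SmallDivisors.rotationSet (SmallDivisors.family α d φ t)) := by
  obtain ⟨b, hb, hbt⟩ := SmallDivisors.exists_mem_rotationSet_family_iff hα hφ hφ2 β
  simp only [hbt]
  have hexcl : ∀ E, SmallDivisors.IsPolar E → (∀ t, t ∈ SmallDivisors.convergenceSet b) →
      ¬ ∀ t ∉ E, t ∉ SmallDivisors.convergenceSet b := by
    intro E hE hall h
    refine SmallDivisors.not_isPolar_univ ?_
    rwa [← Set.eq_univ_of_forall fun t ↦ not_not.1 fun ht ↦ h t ht (hall t)]
  rcases SmallDivisors.isPolar_convergenceSet_or hb with h | h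
  · exact Or.inr ⟨⟨_, SmallDivisors.measurableSet_convergenceSet b, h, fun t ht ↦ ht⟩,
      fun hall ↦ hexcl _ h hall fun t ht ↦ ht⟩
  · have hall : ∀ t, t ∈ SmallDivisors.convergenceSet b := fun t ↦ h ▸ Set.mem_univ t
    exact Or.inl ⟨hall, fun ⟨E, _, hE, hEt⟩ ↦ hexcl E hE hall hEt⟩
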